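/- Let $P_F$ be a probability distribution on $\mathbb{R}$ with zero mean and unit variance that is sub-exponential, i.e. for some $\nu\in\mathbb{R}$ and $b>0$, $\mathbb{E}_{Z\sim P_F}[e^{tZ}]\le e^{\nu^2t^2/2}$ for all $|t|\le 1/b$. Let $m\ge 2$, $\lambda\in[1/2,1)$, and let $f(x,s)$, $x\in\{1,\dots,m\}$, $s\in\{1,2,\dots\}$, be i.i.d. random variables with law $P_F$. For $k\ge 1$ define the random minimax detection gap with token alphabet $\{1,\dots,m\}$ and side-information alphabet $\{1,\dots,k\}$ by $$D_{\mathrm{gap}}^{[P_F]}(m,k,\lambda)=\min_{P_X\in\mathcal{P}_\lambda}\ \max_{P_{XS}}\Bigl(\mathbb{E}_{P_{XS}}[f(X,S)]-\mathbb{E}_{P_XP_S}[f(X,S)]\Bigr),$$ where $\mathcal{P}_\lambda$ is the set of probability vectors $P_X$ on $\{1,\dots,m\}$ with $\|P_X\|_\infty\le\lambda$, $P_S$ is the uniform distribution on $\{1,\dots,k\}$, the maximum is over all couplings $P_{XS}$ of $P_X$ and $P_S$, and the expectations are over $(X,S)$ only, for the given realization of the scores. Let $\Delta=f(x,s)-f(x',s')$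 for some $(x,s)\neq(x',s')$, let $F$ be the cumulative distribution function of $\Delta$, and let $Q(u)=\inf\{z\in\mathbb{R}: F(z)\ge u\}$, $0<u<1$, be its quantile function. Then $Q$ is integrable on $(1-\lambda,1)$ and, almost surely, $$\lim_{k\to\infty}D_{\mathrm{gap}}^{[P_F]}(m,k,\lambda)=\int_{1-\lambda}^{1}Q(u)\,du.$$ -/

import Mathlib

open MeasureTheory ProbabilityTheory Filter Topology

noncomputable section

/-- The law `P` on `ℝ` is sub-exponential with parameters `(ν², b)`:
`𝔼[exp (t Z)] ≤ exp (ν² t² / 2)` (in particular the left side is finite) whenever `|t| ≤ 1 / b`. -/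
def IsSubExponential (P : Measure ℝ) (ν b : ℝ) : Prop :=
  0 < b ∧ ∀ t : ℝ, |t| ≤ 1 / b →
    Integrable (fun z : ℝ => Real.exp (t * z)) P ∧
      ∫ z, Real.exp (t * z) ∂P ≤ Real.exp (ν ^ 2 * t ^ 2 / 2)

/-- The quantile function `Q = F⁻¹` of a law `P` on `ℝ` with cumulative distribution function `F`:
the generalized inverse `Q(u) = inf {x | u ≤ F x}`, for `0 < u < 1`. -/
def quantile (P : Measure ℝ) (u : ℝ) : ℝ :=
  sInf {x : ℝ | u ≤ cdf P x}

/-- Token distributions on `m` tokens whose sup norm is at most `lam`. -/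
def tokenDistributions (m : ℕ) (lam : ℝ) : Set (Fin m → ℝ) :=
  {p | p ∈ stdSimplex ℝ (Fin m) ∧ ∀ x, p x ≤ lam}

/-- Couplings of the token distribution `p` with the uniform distribution on the `k` symbols of
the side-information alphabet. -/
def couplings {m : ℕ} (k : ℕ) (p : Fin m → ℝ) : Set (Fin m → Fin k → ℝ) :=
  {π | (∀ x s, 0 ≤ π x s) ∧ (∀ x, ∑ s, π x s = p x) ∧ ∀ s, ∑ x, π x s = 1 / (k : ℝ)}

/-- `𝔼[g(X, S)]` when `(X, S)` has joint probability mass function `π`. -/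
def expScore {m k : ℕ} (g : Fin m → Fin k → ℝ) (π : Fin m → Fin k → ℝ) : ℝ :=
  ∑ x, ∑ s, π x s * g x s

/-- The largest separation, over all couplings of `p` with the uniform distribution, between the
expected score under the coupling and under the product distribution. (For `0 < k` the couplings
form a non-empty compact set, so this supremum is a maximum.) -/
def maxSeparation {m k : ℕ} (g : Fin m → Fin k → ℝ) (p : Fin m → ℝ) : ℝ :=
  sSup ((fun π => expScore g π - expScore g (fun x _ => p x * (1 / (k : ℝ)))) '' couplings k p)

/-- The minimax detection gap of the score matrix `g`:
the minimum over token distributions `p` with `‖p‖_∞ ≤ lam` of the maximal separation. -/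
def detectionGap {m k : ℕ} (lam : ℝ) (g : Fin m → Fin k → ℝ) : ℝ :=
  sInf (maxSeparation g '' tokenDistributions m lam)

end

/-!
The proof reduces the minimization to pairs of tokens, and treats each pair with the strong law of
large numbers.

*Reduction to pairs.* A mixture of couplings is a coupling of the mixture, and the score under the
product law is linear in the token distribution. Hence the token distributions admitting a coupling
with separation at least `v` form a convex set (`convex_separation_ge`). For `1 / 2 ≤ lam < 1` the
extreme points of `tokenDistributions m lam` are the distributions with mass `lam` on one token `y`
and `1 - lam` on another token `z` (`exists_eq_pairDistribution`), so by Krein–Milman a lower bound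
for the detection gap need only be checked there (`le_detectionGap`), and any single pair gives an
upper bound.

*One pair.* A coupling of such a pair distribution is given by weights `w s ∈ [0, 1 / k]` of total
mass `lam`, and its separation is `∑ w s * Δ s - lam * avg Δ`, where `Δ s` are the score
differences and `avg` is the average over the `k` symbols (`separation_pairCoupling`). For every
threshold `q` this is at most `lam * q + avg (Δ - q)⁺ - lam * avg Δ` (`detectionGap_le`). With
`q = Q (1 - lam)` the limit of this bound is `lam * q + 𝔼 (Δ - q)⁺`, which equals the integral of `Q`
over `(1 - lam, 1)` because `Q` transports the uniform law on `(0, 1)` to the law of `Δ`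
(`map_quantile`, `integral_quantile_tail`). Conversely, the randomized test `h` of level `lam` with
threshold `q` (`exists_thresholdTest`) gives weights `h (Δ s) / k` whose total mass tends to `lam`;
after a correction that is negligible in the limit they are admissible
(`exists_coupling_of_test`), and the resulting separation tends to the same value, since
`h Δ * (Δ - q) = (Δ - q)⁺`.
-/

/-! ### Quantile functions -/

section Quantile

variable (P : Measure ℝ)

/-- The Galois connection between the quantile function and the distribution function. -/
lemma quantile_le_iff {u : ℝ} (hu : u ∈ Set.Ioo (0 : ℝ) 1) (x : ℝ) :
    quantile P u ≤ x ↔ u ≤ cdf P x := by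
  have hbdd : BddBelow {x : ℝ | u ≤ cdf P x} := by
    obtain ⟨a, ha⟩ := ((tendsto_cdf_atBot P).eventually_lt_const hu.1).exists
    refine ⟨a, fun y hy => ?_⟩
    by_contra! h
    exact absurd (hy.trans (monotone_cdf P h.le)) (not_le.2 ha)
  have hne : {x : ℝ | u ≤ cdf P x}.Nonempty := by
    obtain ⟨a, ha⟩ := ((tendsto_cdf_atTop P).eventually_const_lt hu.2).exists
    exact ⟨a, ha.le⟩
  refine ⟨fun h => ?_, fun h => csInf_le hbdd h⟩
  refine le_trans ?_ (monotone_cdf P h)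
  -- the infimum is attained because the distribution function is right-continuous
  have hr : Tendsto (cdf P) (𝓝[>] (quantile P u)) (𝓝 (cdf P (quantile P u))) :=
    ((cdf P).right_continuous _).tendsto.mono_left (nhdsWithin_mono _ Set.Ioi_subset_Ici_self)
  refine ge_of_tendsto hr ?_
  filter_upwards [self_mem_nhdsWithin] with y hy
  obtain ⟨z, hz, hzy⟩ := exists_lt_of_csInf_lt hne hy
  exact le_trans hz (monotone_cdf P hzy.le)

lemma monotoneOn_quantile : MonotoneOn (quantile P) (Set.Ioo 0 1) := fun _ hu _ hv huv =>
  (quantile_le_iff P hu _).2 (huv.trans ((quantile_le_iff P hv _).1 le_rfl))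

lemma aemeasurable_quantile :
    AEMeasurable (quantile P) (volume.restrict (Set.Ioo (0 : ℝ) 1)) :=
  aemeasurable_restrict_of_monotoneOn measurableSet_Ioo (monotoneOn_quantile P)

variable [IsProbabilityMeasure P]

/-- Inverse transform sampling: the quantile function maps the uniform law on `(0, 1)` to `P`. -/
lemma map_quantile : (volume.restrict (Set.Ioo (0 : ℝ) 1)).map (quantile P) = P := by
  refine Measure.ext_of_Iic _ _ fun x => ?_
  have hI : MeasurableSet (Set.Iic (cdf P x)) := measurableSet_Iic
  have hae : (quantile P ⁻¹' Set.Iic x : Set ℝ)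
      =ᵐ[volume.restrict (Set.Ioo (0 : ℝ) 1)] Set.Iic (cdf P x) := by
    filter_upwards [ae_restrict_mem measurableSet_Ioo] with u hu
    exact propext (quantile_le_iff P hu x)
  rw [Measure.map_apply_of_aemeasurable (aemeasurable_quantile P) measurableSet_Iic,
    measure_congr hae, Measure.restrict_apply hI, ← ofReal_cdf P x]
  have h0 : Set.Ioo (0 : ℝ) (cdf P x) ⊆ Set.Iic (cdf P x) ∩ Set.Ioo 0 1 := fun u hu =>
    ⟨hu.2.le, hu.1, hu.2.trans_le (cdf_le_one P x)⟩
  have h1 : Set.Iic (cdf P x) ∩ Set.Ioo (0 : ℝ) 1 ⊆ Set.Ioc 0 (cdf P x) := fun u hu =>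
    ⟨hu.2.1, hu.1⟩
  refine le_antisymm ((measure_mono h1).trans ?_) (le_trans ?_ (measure_mono h0)) <;> simp

lemma integral_comp_quantile {φ : ℝ → ℝ} (hφ : Measurable φ) :
    ∫ u in Set.Ioo (0 : ℝ) 1, φ (quantile P u) = ∫ z, φ z ∂P := by
  conv_rhs => rw [← map_quantile P]
  rw [integral_map (aemeasurable_quantile P) hφ.aestronglyMeasurable]

lemma integrableOn_quantile (hP : Integrable id P) :
    IntegrableOn (quantile P) (Set.Ioo 0 1) := by
  rw [← map_quantile P] at hP
  exact hP.comp_aemeasurable (aemeasurable_quantile P)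

variable {lam : ℝ}

lemma intervalIntegrable_quantile (hP : Integrable id P) (h0 : 0 ≤ lam) (h1 : lam ≤ 1) :
    IntervalIntegrable (quantile P) volume (1 - lam) 1 := by
  rw [intervalIntegrable_iff_integrableOn_Ioo_of_le (by linarith)]
  exact (integrableOn_quantile P hP).mono_set (Set.Ioo_subset_Ioo_left (by linarith))

/-- The upper tail integral of the quantile function is the expected shortfall, in the form given
by Rockafellar and Uryasev. -/
lemma integral_quantile_tail (hP : Integrable id P) (h0 : 0 < lam) (h1 : lam < 1) :
    ∫ u in (1 - lam)..1, quantile P u =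
      lam * quantile P (1 - lam) + ∫ z, max (z - quantile P (1 - lam)) 0 ∂P := by
  set q := quantile P (1 - lam) with hq
  have hmem : 1 - lam ∈ Set.Ioo (0 : ℝ) 1 := ⟨by linarith, by linarith⟩
  have hii := intervalIntegrable_quantile P hP h0.le h1.le
  have hcomp := integral_comp_quantile P (φ := fun z => max (z - q) 0) (by fun_prop)
  have hsplit : ∫ u in Set.Ioo (0 : ℝ) 1, max (quantile P u - q) 0 =
      ∫ u in Set.Ioo (1 - lam) 1, (quantile P u - q) := by
    rw [setIntegral_eq_of_subset_of_forall_sdiff_eq_zero (t := Set.Ioo (0 : ℝ) 1)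
      (s := Set.Ioo (1 - lam) 1) (f := fun u => max (quantile P u - q) 0) measurableSet_Ioo
      (Set.Ioo_subset_Ioo_left (by linarith))]
    · refine setIntegral_congr_fun measurableSet_Ioo fun u hu => ?_
      refine max_eq_left (sub_nonneg.2 ?_)
      exact monotoneOn_quantile P hmem ⟨hmem.1.trans hu.1, hu.2⟩ hu.1.le
    · intro u hu
      have : u ≤ 1 - lam := not_lt.1 fun h => hu.2 ⟨h, hu.1.2⟩
      exact max_eq_right (sub_nonpos.2 (monotoneOn_quantile P hu.1 hmem this))
  rw [← hcomp, hsplit, ← integral_Ioc_eq_integral_Ioo,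
    ← intervalIntegral.integral_of_le (by linarith), intervalIntegral.integral_sub hii (by simp)]
  simp

/-- A randomized threshold test of level exactly `lam`: accept above the quantile
`quantile P (1 - lam)`, reject below it, and split the possible atom there. -/
lemma exists_thresholdTest (h0 : 0 < lam) (h1 : lam < 1) :
    ∃ h : ℝ → ℝ, Measurable h ∧ (∀ z, 0 ≤ h z) ∧ (∀ z, h z ≤ 1) ∧ ∫ z, h z ∂P = lam ∧
      ∀ z, h z * (z - quantile P (1 - lam)) = max (z - quantile P (1 - lam)) 0 := by
  set q := quantile P (1 - lam) with hq
  have hmem : 1 - lam ∈ Set.Ioo (0 : ℝ) 1 := ⟨by linarith, by linarith⟩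
  have hgt : P.real (Set.Ioi q) ≤ lam := by
    have h : 1 - lam ≤ P.real (Set.Iic q) := by
      rw [← cdf_eq_real]; exact (quantile_le_iff P hmem q).1 le_rfl
    rw [← Set.compl_Iic, probReal_compl_eq_one_sub measurableSet_Iic]
    linarith
  have hlt : P.real (Set.Iio q) ≤ 1 - lam := by
    have : P (Set.Iio q) ≤ ENNReal.ofReal (1 - lam) := by
      conv_lhs => rw [← map_quantile P]
      rw [Measure.map_apply_of_aemeasurable (aemeasurable_quantile P) measurableSet_Iio,
        Measure.restrict_apply' measurableSet_Ioo]
      calc volume (quantile P ⁻¹' Set.Iio q ∩ Set.Ioo 0 1)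
          ≤ volume (Set.Ioo 0 (1 - lam)) := by
            refine measure_mono fun u hu => ⟨hu.2.1, ?_⟩
            by_contra! h
            exact absurd (monotoneOn_quantile P hmem hu.2 h) (not_le.2 hu.1)
        _ = ENNReal.ofReal (1 - lam) := by simp
    exact ENNReal.toReal_le_of_le_ofReal (by linarith) this
  have hsum : P.real (Set.Iio q) + P.real {q} + P.real (Set.Ioi q) = 1 := by
    have e1 : P.real (Set.Iic q) = P.real (Set.Iio q) + P.real {q} := by
      rw [← Set.Iio_union_right, measureReal_union (by simp) (measurableSet_singleton q)]
    rw [← e1, ← Set.compl_Iic, probReal_compl_eq_one_sub measurableSet_Iic]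
    ring
  obtain ⟨c, hc0, hc1, hc⟩ :
      ∃ c : ℝ, 0 ≤ c ∧ c ≤ 1 ∧ P.real (Set.Ioi q) + c * P.real {q} = lam := by
    rcases (measureReal_nonneg : 0 ≤ P.real {q}).eq_or_lt with hb | hb
    · exact ⟨0, le_rfl, zero_le_one, by linarith⟩
    · refine ⟨(lam - P.real (Set.Ioi q)) / P.real {q}, div_nonneg (by linarith) hb.le,
        (div_le_one hb).2 (by linarith), ?_⟩
      field_simp
      ring
  refine ⟨fun z => (Set.Ioi q).indicator 1 z + c * ({q} : Set ℝ).indicator 1 z,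
    ?_, fun z => ?_, fun z => ?_, ?_, fun z => ?_⟩
  · exact (measurable_one.indicator measurableSet_Ioi).add
      ((measurable_one.indicator (measurableSet_singleton q)).const_mul c)
  · have : ∀ s : Set ℝ, 0 ≤ s.indicator (1 : ℝ → ℝ) z := fun s =>
      Set.indicator_nonneg (fun _ _ => zero_le_one) z
    exact add_nonneg (this _) (mul_nonneg hc0 (this _))
  · rcases lt_trichotomy z q with h | h | h
    · simp [Set.indicator, h.not_gt, h.ne]
    · simp [h, hc1]
    · simp [Set.indicator, h, h.ne']
  · have i1 : Integrable ((Set.Ioi q).indicator (1 : ℝ → ℝ)) P :=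
      (integrable_const (1 : ℝ)).indicator measurableSet_Ioi
    have i2 : Integrable (({q} : Set ℝ).indicator (1 : ℝ → ℝ)) P :=
      (integrable_const (1 : ℝ)).indicator (measurableSet_singleton q)
    rw [integral_add i1 (i2.const_mul c), integral_const_mul, integral_indicator_one
      measurableSet_Ioi, integral_indicator_one (measurableSet_singleton q), hc]
  · rcases lt_trichotomy z q with h | h | h
    · simp [Set.indicator, h.not_gt, h.ne, h.le]
    · simp [h]
    · simp [Set.indicator, h, h.ne', h.le]

end Quantile

/-! ### Token distributions and their extreme points -/

/-- The token distribution putting mass `lam` on `y` and `1 - lam` on `z`. -/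
noncomputable def pairDistribution {m : ℕ} (lam : ℝ) (y z : Fin m) : Fin m → ℝ :=
  Pi.single y lam + Pi.single z (1 - lam)

section TokenDistributions

variable {m : ℕ} {lam : ℝ}

lemma pairDistribution_mem (h0 : 1 / 2 ≤ lam) (h1 : lam < 1) {y z : Fin m} (hyz : y ≠ z) :
    pairDistribution lam y z ∈ tokenDistributions m lam := by
  refine ⟨⟨fun x => ?_, ?_⟩, fun x => ?_⟩
  · simp only [pairDistribution, Pi.add_apply, Pi.single_apply]
    split_ifs <;> linarith
  · simp [pairDistribution, Finset.sum_add_distrib]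
  · simp only [pairDistribution, Pi.add_apply, Pi.single_apply]
    split_ifs with h h'
    · exact absurd (h.symm.trans h') hyz
    all_goals linarith

lemma convex_tokenDistributions : Convex ℝ (tokenDistributions m lam) := by
  have : tokenDistributions m lam = stdSimplex ℝ (Fin m) ∩ Set.Iic fun _ => lam := rfl
  rw [this]
  exact (convex_stdSimplex ℝ _).inter (convex_Iic _)

lemma isCompact_tokenDistributions : IsCompact (tokenDistributions m lam) := by
  have : tokenDistributions m lam = stdSimplex ℝ (Fin m) ∩ Set.Iic fun _ => lam := rfl
  rw [this]
  exact (isCompact_stdSimplex ℝ _).inter_right isClosed_Iic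

/-- An extreme point has at most one coordinate strictly between `0` and `lam`: otherwise mass can
be moved between two such coordinates in both directions. -/
lemma eq_of_mem_extremePoints {p : Fin m → ℝ}
    (hp : p ∈ (tokenDistributions m lam).extremePoints ℝ) {i j : Fin m}
    (hi : p i ∈ Set.Ioo 0 lam) (hj : p j ∈ Set.Ioo 0 lam) : i = j := by
  by_contra hij
  obtain ⟨ε, hε, h1, h2, h3, h4⟩ : ∃ ε > 0, ε ≤ p i ∧ ε ≤ p j ∧ ε ≤ lam - p i ∧ ε ≤ lam - p j := by
    refine ⟨min (min (p i) (p j)) (min (lam - p i) (lam - p j)), ?_, ?_⟩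
    · have := hi.1; have := hi.2; have := hj.1; have := hj.2
      simp only [gt_iff_lt, lt_min_iff]
      refine ⟨⟨?_, ?_⟩, ?_, ?_⟩ <;> linarith
    · simp
  obtain ⟨⟨⟨hp0, hp1⟩, hpl⟩, hext⟩ := mem_extremePoints.1 hp
  have hmem : ∀ δ : ℝ, |δ| ≤ ε → p + (Pi.single i δ - Pi.single j δ) ∈ tokenDistributions m lam := by
    intro δ hδ
    have := abs_le.1 hδ
    refine ⟨⟨fun x => ?_, ?_⟩, fun x => ?_⟩
    · have := hp0 x
      simp only [Pi.add_apply, Pi.sub_apply, Pi.single_apply]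
      split_ifs <;> subst_vars <;> linarith
    · simp [Finset.sum_add_distrib, hp1]
    · have := hpl x
      simp only [Pi.add_apply, Pi.sub_apply, Pi.single_apply]
      split_ifs <;> subst_vars <;> linarith
  have hseg : p ∈ openSegment ℝ (p + (Pi.single i ε - Pi.single j ε))
      (p + (Pi.single i (-ε) - Pi.single j (-ε))) := by
    refine ⟨1 / 2, 1 / 2, by norm_num, by norm_num, by norm_num, ?_⟩
    simp only [Pi.single_neg]
    module
  have := (hext _ (hmem ε (abs_of_pos hε).le) _ (hmem (-ε) (by rw [abs_neg, abs_of_pos hε]))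
    hseg).1
  have := congrFun this i
  simp [hij] at this
  exact hε.ne' this

/-- For `1 / 2 ≤ lam < 1` every extreme point is a `pairDistribution`. -/
lemma exists_eq_pairDistribution (h0 : 1 / 2 ≤ lam) (h1 : lam < 1) {p : Fin m → ℝ}
    (hp : p ∈ (tokenDistributions m lam).extremePoints ℝ) :
    ∃ y z, y ≠ z ∧ p = pairDistribution lam y z := by
  obtain ⟨⟨hp0, hp1⟩, hpl⟩ := hp.1
  -- some coordinate equals `lam`: otherwise only one coordinate is nonzero, and its mass is
  -- `1 > lam`
  obtain ⟨y, hy⟩ : ∃ y, p y = lam := by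
    by_contra! hne
    obtain ⟨i, hi⟩ : ∃ i, 0 < p i := by
      by_contra! h
      have := Finset.sum_nonpos fun i (_ : i ∈ Finset.univ) => h i
      linarith
    have hz : ∀ j, j ≠ i → p j = 0 := by
      intro j hji
      by_contra hj
      exact hji (eq_of_mem_extremePoints hp ⟨lt_of_le_of_ne (hp0 j) (Ne.symm hj),
        lt_of_le_of_ne (hpl j) (hne j)⟩ ⟨hi, lt_of_le_of_ne (hpl i) (hne i)⟩)
    rw [Finset.sum_eq_single i (fun j _ => hz j) (by simp)] at hp1
    linarith [hpl i]
  have hrest : ∑ x ∈ Finset.univ.erase y, p x = 1 - lam := by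
    have := Finset.add_sum_erase Finset.univ p (Finset.mem_univ y)
    linarith
  obtain ⟨z, hzy, hz⟩ : ∃ z, z ≠ y ∧ 0 < p z := by
    by_contra! h
    have := Finset.sum_nonpos fun i (hi : i ∈ Finset.univ.erase y) => h i (Finset.ne_of_mem_erase hi)
    linarith
  have hle : ∀ x, x ≠ y → x ≠ z → p x + p z ≤ 1 - lam := by
    intro x hx hxz
    rw [← hrest, ← Finset.sum_pair hxz]
    refine Finset.sum_le_sum_of_subset_of_nonneg (fun t ht => ?_) fun t _ _ => hp0 t
    rcases Finset.mem_insert.1 ht with rfl | ht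
    · simp [hx]
    · simpa [Finset.mem_singleton.1 ht] using hzy
  have hzero : ∀ x, x ≠ y → x ≠ z → p x = 0 := by
    intro x hx hxz
    by_contra hx0
    have hxpos := lt_of_le_of_ne (hp0 x) (Ne.symm hx0)
    have := hle x hx hxz
    exact hxz (eq_of_mem_extremePoints hp ⟨hxpos, by linarith⟩ ⟨hz, by linarith⟩)
  have hpz : p z = 1 - lam := by
    rw [← hrest]
    refine (Finset.sum_eq_single z (fun x hx hxz => hzero x (Finset.ne_of_mem_erase hx) hxz)
      fun h => absurd (Finset.mem_erase.2 ⟨hzy, Finset.mem_univ z⟩) h).symm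
  refine ⟨y, z, hzy.symm, funext fun x => ?_⟩
  by_cases hxy : x = y
  · subst hxy; simp [pairDistribution, hy, hzy.symm]
  by_cases hxz : x = z
  · subst hxz; simp [pairDistribution, hpz, hzy]
  · simp [pairDistribution, hxy, hxz, hzero x hxy hxz]

/-- By the Krein–Milman theorem, a convex set containing all `pairDistribution`s contains all token
distributions. -/
lemma tokenDistributions_subset (h0 : 1 / 2 ≤ lam) (h1 : lam < 1) {C : Set (Fin m → ℝ)}
    (hC : Convex ℝ C) (hpair : ∀ y z, y ≠ z → pairDistribution lam y z ∈ C) :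
    tokenDistributions m lam ⊆ C := by
  have hsub : (tokenDistributions m lam).extremePoints ℝ ⊆
      C ∩ Set.range fun i : Fin m × Fin m => pairDistribution lam i.1 i.2 := by
    intro p hp
    obtain ⟨y, z, hyz, rfl⟩ := exists_eq_pairDistribution h0 h1 hp
    exact ⟨hpair y z hyz, (y, z), rfl⟩
  have hfin : ((tokenDistributions m lam).extremePoints ℝ).Finite :=
    (Set.finite_range _).subset (hsub.trans Set.inter_subset_right)
  rw [← closure_convexHull_extremePoints isCompact_tokenDistributions convex_tokenDistributions,
    (hfin.isClosed_convexHull ℝ).closure_eq]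
  exact convexHull_min (hsub.trans Set.inter_subset_left) hC

end TokenDistributions

/-! ### Separation for a given score matrix -/

section Separation

variable {m k : ℕ} (g : Fin m → Fin k → ℝ)

lemma expScore_add (π ρ : Fin m → Fin k → ℝ) :
    expScore g (π + ρ) = expScore g π + expScore g ρ := by
  simp [expScore, add_mul, Finset.sum_add_distrib]

lemma expScore_smul (a : ℝ) (π : Fin m → Fin k → ℝ) :
    expScore g (a • π) = a * expScore g π := by
  simp [expScore, Finset.mul_sum, mul_assoc]

lemma expScore_single (y : Fin m) (w : Fin k → ℝ) :
    expScore g (Pi.single y w) = ∑ s, w s * g y s := by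
  unfold expScore
  rw [Finset.sum_eq_single y (fun x _ hx => by simp [Pi.single_eq_of_ne hx]) (by simp)]
  simp

/-- The difference between the expected scores under `π` and under the product of `p` with the
uniform distribution. -/
noncomputable def separation (p : Fin m → ℝ) (π : Fin m → Fin k → ℝ) : ℝ :=
  expScore g π - expScore g (fun x _ => p x * (1 / (k : ℝ)))

lemma bddAbove_separation {p : Fin m → ℝ} :
    BddAbove (separation g p '' couplings k p) := by
  refine ⟨∑ x, ∑ s, p x * |g x s| - expScore g (fun x _ => p x * (1 / (k : ℝ))), ?_⟩
  rintro _ ⟨π, ⟨hπ0, hπp, -⟩, rfl⟩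
  refine sub_le_sub_right (Finset.sum_le_sum fun x _ => Finset.sum_le_sum fun s _ => ?_) _
  have h1 : π x s ≤ p x := by
    rw [← hπp x]
    exact Finset.single_le_sum (fun t _ => hπ0 x t) (Finset.mem_univ s)
  calc π x s * g x s ≤ π x s * |g x s| := mul_le_mul_of_nonneg_left (le_abs_self _) (hπ0 x s)
    _ ≤ p x * |g x s| := mul_le_mul_of_nonneg_right h1 (abs_nonneg _)

lemma le_maxSeparation {p : Fin m → ℝ} {π : Fin m → Fin k → ℝ} (hπ : π ∈ couplings k p) :
    separation g p π ≤ maxSeparation g p :=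
  le_csSup (bddAbove_separation g) ⟨π, hπ, rfl⟩

/-- Mixtures of couplings are couplings of the mixtures, so attaining separation `v` is a convex
condition on the token distribution. -/
lemma convex_separation_ge (v : ℝ) :
    Convex ℝ {p : Fin m → ℝ | ∃ π ∈ couplings k p, v ≤ separation g p π} := by
  rintro p ⟨π, hπ, hv⟩ p' ⟨π', hπ', hv'⟩ a b ha hb hab
  refine ⟨a • π + b • π', ⟨fun x s => ?_, fun x => ?_, fun s => ?_⟩, ?_⟩
  · have := hπ.1 x s
    have := hπ'.1 x s
    simp only [Pi.add_apply, Pi.smul_apply, smul_eq_mul]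
    positivity
  · simp [Finset.sum_add_distrib, ← Finset.mul_sum, hπ.2.1, hπ'.2.1]
  · simp only [Pi.add_apply, Pi.smul_apply, smul_eq_mul, Finset.sum_add_distrib,
      ← Finset.mul_sum, hπ.2.2, hπ'.2.2]
    rw [← add_mul, hab, one_mul]
  · have hprod : (fun (x : Fin m) (_ : Fin k) => (a • p + b • p') x * (1 / (k : ℝ))) =
        a • (fun x _ => p x * (1 / (k : ℝ)) : Fin m → Fin k → ℝ) +
          b • (fun x _ => p' x * (1 / (k : ℝ)) : Fin m → Fin k → ℝ) := by
      ext x s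
      simp only [Pi.add_apply, Pi.smul_apply, smul_eq_mul]
      ring
    have : separation g (a • p + b • p') (a • π + b • π') =
        a * separation g p π + b * separation g p' π' := by
      unfold separation
      rw [hprod]
      simp only [expScore_add, expScore_smul]
      ring
    rw [this]
    calc v = a * v + b * v := by rw [← add_mul, hab, one_mul]
      _ ≤ _ := by gcongr

variable {lam : ℝ}

/-- If every pair distribution admits a coupling with separation at least `v`, then the detection
gap is at least `v`. -/
lemma le_detectionGap (hm : 2 ≤ m) (h0 : 1 / 2 ≤ lam) (h1 : lam < 1) {v : ℝ}
    (hv : ∀ y z, y ≠ z → ∃ π ∈ couplings k (pairDistribution lam y z),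
      v ≤ separation g (pairDistribution lam y z) π) :
    v ≤ detectionGap lam g := by
  have hne : (tokenDistributions m lam).Nonempty :=
    ⟨_, pairDistribution_mem h0 h1 (y := ⟨0, by omega⟩) (z := ⟨1, by omega⟩) (by simp)⟩
  refine le_csInf (hne.image _) ?_
  rintro _ ⟨p, hp, rfl⟩
  obtain ⟨π, hπ, hle⟩ := tokenDistributions_subset h0 h1 (convex_separation_ge g v) hv hp
  exact hle.trans (le_maxSeparation g hπ)

/-- The coupling of a pair distribution in which `w s` is the joint mass of `y` and `s`. -/
noncomputable def pairCoupling (y z : Fin m) (w : Fin k → ℝ) : Fin m → Fin k → ℝ :=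
  Pi.single y w + Pi.single z fun s => 1 / (k : ℝ) - w s

lemma pairCoupling_mem (hk : 0 < k) {y z : Fin m} {w : Fin k → ℝ} (hw0 : ∀ s, 0 ≤ w s)
    (hw1 : ∀ s, w s ≤ 1 / (k : ℝ)) (hw : ∑ s, w s = lam) :
    pairCoupling y z w ∈ couplings k (pairDistribution lam y z) := by
  have hk' : (k : ℝ) ≠ 0 := by positivity
  have happ : ∀ (x a : Fin m) (v : Fin k → ℝ) s,
      (Pi.single a v : Fin m → Fin k → ℝ) x s = if x = a then v s else 0 := by
    intro x a v s
    rw [Pi.single_apply]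
    split_ifs <;> rfl
  refine ⟨fun x s => ?_, fun x => ?_, fun s => ?_⟩
  · have := hw0 s
    have := hw1 s
    simp only [pairCoupling, Pi.add_apply, happ]
    split_ifs <;> linarith
  · simp only [pairCoupling, pairDistribution, Pi.add_apply, Pi.single_apply,
      Finset.sum_add_distrib]
    split_ifs <;> simp [hw, hk']
  · simp [pairCoupling, happ, Finset.sum_add_distrib]

/-- For a pair distribution only the score differences matter. -/
lemma separation_pairCoupling (y z : Fin m) (w : Fin k → ℝ) :
    separation g (pairDistribution lam y z) (pairCoupling y z w) =
      ∑ s, w s * (g y s - g z s) - lam * ((∑ s, (g y s - g z s)) / k) := by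
  have hprod : (fun (x : Fin m) (_ : Fin k) => pairDistribution lam y z x * (1 / (k : ℝ))) =
      Pi.single y (fun _ => lam * (1 / (k : ℝ))) +
        Pi.single z (fun _ => (1 - lam) * (1 / (k : ℝ))) := by
    ext x s
    simp only [pairDistribution, Pi.add_apply, Pi.single_apply]
    split_ifs <;> simp only [Pi.zero_apply] <;> ring
  unfold separation
  rw [hprod, pairCoupling]
  simp only [expScore_add, expScore_single, sub_mul, mul_sub, Finset.sum_sub_distrib,
    ← Finset.mul_sum]
  ring

lemma eq_pairCoupling {y z : Fin m} (hyz : y ≠ z) {π : Fin m → Fin k → ℝ}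
    (hπ : π ∈ couplings k (pairDistribution lam y z)) : π = pairCoupling y z (π y) := by
  have hz : ∀ x, x ≠ y → x ≠ z → ∀ s, π x s = 0 := by
    intro x hxy hxz s
    have h := hπ.2.1 x
    simp only [pairDistribution, Pi.add_apply, Pi.single_apply, hxy, hxz, if_false, add_zero] at h
    exact (Finset.sum_eq_zero_iff_of_nonneg fun t _ => hπ.1 x t).1 h s (Finset.mem_univ s)
  ext x s
  by_cases hxy : x = y
  · subst hxy; simp [pairCoupling, Pi.single_eq_of_ne hyz]
  by_cases hxz : x = z
  · subst hxz
    have h := hπ.2.2 s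
    rw [← Finset.sum_subset (Finset.subset_univ {y, x}) (fun t _ ht => hz t (by
      rintro rfl; simp at ht) (by rintro rfl; simp at ht) s), Finset.sum_pair hyz] at h
    simp [pairCoupling, Pi.single_eq_of_ne hxy]
    simp at h
    linarith
  · simp [pairCoupling, Pi.single_eq_of_ne hxy, Pi.single_eq_of_ne hxz, hz x hxy hxz s]

/-- Weak duality: every threshold `q` gives an upper bound on the separation at a pair
distribution. -/
lemma detectionGap_le (hk : 0 < k) (h0 : 1 / 2 ≤ lam) (h1 : lam < 1) {y z : Fin m} (hyz : y ≠ z)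
    (q : ℝ) :
    detectionGap lam g ≤ lam * q + (∑ s, max (g y s - g z s - q) 0) / k -
      lam * ((∑ s, (g y s - g z s)) / k) := by
  have hk' : (0 : ℝ) < k := by positivity
  -- the constant weight `lam / k` is admissible, so couplings exist
  have hcoup : pairCoupling y z (fun _ : Fin k => lam / k) ∈
      couplings k (pairDistribution lam y z) :=
    pairCoupling_mem hk (fun _ => by positivity) (fun _ => by gcongr) (by simp; field_simp)
  have hmem := pairDistribution_mem h0 h1 hyz
  have hbdd : BddBelow (maxSeparation g '' tokenDistributions m lam) := by
    refine ⟨0, ?_⟩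
    rintro _ ⟨p, hp, rfl⟩
    have hπ : (fun x _ => p x * (1 / (k : ℝ))) ∈ couplings k p :=
      ⟨fun x _ => mul_nonneg (hp.1.1 x) (by positivity), fun x => by simp; field_simp,
        fun s => by rw [← Finset.sum_mul, hp.1.2, one_mul]⟩
    have := le_maxSeparation g hπ
    rwa [separation, sub_self] at this
  refine (csInf_le hbdd ⟨_, hmem, rfl⟩).trans ?_
  refine csSup_le (Set.Nonempty.image _ ⟨_, hcoup⟩) ?_
  rintro _ ⟨π, hπ, rfl⟩
  change separation g _ π ≤ _
  rw [eq_pairCoupling hyz hπ, separation_pairCoupling]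
  refine sub_le_sub_right ?_ _
  have hw : ∑ s, π y s = lam := by
    rw [hπ.2.1 y]; simp [pairDistribution, Pi.single_eq_of_ne hyz]
  have hle : ∀ s, π y s ≤ 1 / (k : ℝ) := fun s => by
    rw [← hπ.2.2 s]
    exact Finset.single_le_sum (f := fun x => π x s) (fun x _ => hπ.1 x s) (Finset.mem_univ y)
  rw [← hw, Finset.sum_mul, Finset.sum_div, ← Finset.sum_add_distrib]
  refine Finset.sum_le_sum fun s _ => ?_
  have e1 : π y s * (g y s - g z s - q) ≤ π y s * max (g y s - g z s - q) 0 :=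
    mul_le_mul_of_nonneg_left (le_max_left _ _) (hπ.1 y s)
  have e2 : π y s * max (g y s - g z s - q) 0 ≤ 1 / (k : ℝ) * max (g y s - g z s - q) 0 :=
    mul_le_mul_of_nonneg_right (hle s) (le_max_right _ _)
  have e3 : 1 / (k : ℝ) * max (g y s - g z s - q) 0 = max (g y s - g z s - q) 0 / k := by ring
  linarith

/-- Test values `h s ∈ [0, 1]` whose average `H` is near `lam` become admissible weights after
scaling `h` down (if `lam ≤ H`) or scaling `1 - h` down (if `H < lam`). -/
lemma exists_coupling_of_test (hk : 0 < k) (h0 : 0 < lam) (h1 : lam < 1) (y z : Fin m)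
    {h : Fin k → ℝ} (hh0 : ∀ s, 0 ≤ h s) (hh1 : ∀ s, h s ≤ 1) {H A B : ℝ}
    (hH : H = (∑ s, h s) / k) (hA : A = (∑ s, h s * (g y s - g z s)) / k)
    (hB : B = (∑ s, (g y s - g z s)) / k) :
    ∃ π ∈ couplings k (pairDistribution lam y z),
      min (lam / H * A - lam * B) (B - (1 - lam) / (1 - H) * (B - A) - lam * B) ≤
        separation g (pairDistribution lam y z) π := by
  have hk' : (0 : ℝ) < k := by positivity
  rcases le_or_gt lam H with hle | hlt
  · have hHpos : 0 < H := h0.trans_le hle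
    have hr : lam / H ≤ 1 := (div_le_one hHpos).2 hle
    have hr0 : 0 ≤ lam / H := by positivity
    refine ⟨pairCoupling y z fun s => lam / H * (h s / k),
      pairCoupling_mem hk (fun s => ?_) (fun s => ?_) ?_, ?_⟩
    · have := hh0 s
      positivity
    · have : h s / k ≤ 1 / k := by gcongr; exact hh1 s
      exact (mul_le_of_le_one_left (div_nonneg (hh0 s) hk'.le) hr).trans this
    · rw [← Finset.mul_sum, ← Finset.sum_div, ← hH, div_mul_cancel₀ _ hHpos.ne']
    · refine (min_le_left _ _).trans_eq ?_
      rw [separation_pairCoupling, ← hB, hA, Finset.sum_div, Finset.mul_sum]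
      congr 1
      exact Finset.sum_congr rfl fun s _ => by ring
  · have hHlt : 0 < 1 - H := by linarith
    have hr : (1 - lam) / (1 - H) ≤ 1 := (div_le_one hHlt).2 (by linarith)
    have hr0 : 0 ≤ (1 - lam) / (1 - H) := div_nonneg (by linarith) hHlt.le
    refine ⟨pairCoupling y z fun s => 1 / k * (1 - (1 - lam) / (1 - H) * (1 - h s)),
      pairCoupling_mem hk (fun s => ?_) (fun s => ?_) ?_, ?_⟩
    · have : (1 - lam) / (1 - H) * (1 - h s) ≤ 1 :=
        mul_le_one₀ hr (by linarith [hh1 s]) (by linarith [hh0 s])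
      exact mul_nonneg (by positivity) (by linarith)
    · have : 0 ≤ (1 - lam) / (1 - H) * (1 - h s) := mul_nonneg hr0 (by linarith [hh1 s])
      exact mul_le_of_le_one_right (by positivity) (by linarith)
    · have hs : ∑ s, h s = k * H := by rw [hH]; field_simp
      rw [← Finset.mul_sum, Finset.sum_sub_distrib, ← Finset.mul_sum, Finset.sum_sub_distrib, hs]
      simp
      field_simp
      ring
    · refine (min_le_right _ _).trans_eq ?_
      rw [separation_pairCoupling, ← hB]
      congr 1
      have : ∀ s, 1 / (k : ℝ) * (1 - (1 - lam) / (1 - H) * (1 - h s)) * (g y s - g z s) =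
          (g y s - g z s) / k - (1 - lam) / (1 - H) *
            ((g y s - g z s) / k - h s * (g y s - g z s) / k) := fun s => by ring
      simp only [this]
      rw [Finset.sum_sub_distrib, ← Finset.mul_sum, Finset.sum_sub_distrib, ← Finset.sum_div,
        ← Finset.sum_div, ← hA, ← hB]

end Separation

/-! ### Almost sure convergence -/

section Convergence

variable {Ω : Type*} [MeasurableSpace Ω] {μ : Measure Ω}

/-- The strong law of large numbers for a function of pairwise independent variables with common
law `D`. -/
lemma ae_tendsto_average {D : Measure ℝ} {X : ℕ → Ω → ℝ} (hX : ∀ s, HasLaw (X s) D μ)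
    (hindep : Pairwise fun s t => IndepFun (X s) (X t) μ) {φ : ℝ → ℝ} (hφ : Measurable φ)
    (hint : Integrable φ D) :
    ∀ᵐ ω ∂μ, Tendsto (fun k : ℕ => (∑ s : Fin k, φ (X s ω)) / (k : ℝ)) atTop
      (𝓝 (∫ z, φ z ∂D)) := by
  have h := strong_law_ae_real (μ := μ) (fun s ω => φ (X s ω)) ?_
    (fun s t hst => (hindep hst).comp hφ hφ)
    (fun s => ((hX s).identDistrib (hX 0)).comp hφ)
  · have hmean : ∫ ω, φ (X 0 ω) ∂μ = ∫ z, φ z ∂D :=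
      (hX 0).integral_comp hφ.aestronglyMeasurable
    rw [hmean] at h
    filter_upwards [h] with ω hω
    simpa only [← Fin.sum_univ_eq_sum_range fun s => φ (X s ω)] using hω
  · rw [← (hX 0).map_eq] at hint
    exact hint.comp_aemeasurable (hX 0).aemeasurable

variable {m : ℕ} {lam : ℝ} {f : Fin m → ℕ → Ω → ℝ} {D : Measure ℝ} [IsProbabilityMeasure D]

/-- Asymptotic upper bound: weak duality at one pair of tokens, with the population quantile as
threshold. -/
lemma ae_eventually_detectionGap_lt (h0 : 1 / 2 ≤ lam) (h1 : lam < 1) (hD : Integrable id D)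
    (hD0 : ∫ z, z ∂D = 0) {y z : Fin m} (hyz : y ≠ z)
    (hlaw : ∀ s, HasLaw (fun ω => f y s ω - f z s ω) D μ)
    (hindep : Pairwise fun s t =>
      IndepFun (fun ω => f y s ω - f z s ω) (fun ω => f y t ω - f z t ω) μ) :
    ∀ᵐ ω ∂μ, ∀ v > ∫ u in (1 - lam)..1, quantile D u, ∀ᶠ k : ℕ in atTop,
      detectionGap lam (fun (y : Fin m) (t : Fin k) => f y t ω) < v := by
  set q := quantile D (1 - lam) with hq
  have hpos : Integrable (fun z => max (z - q) 0) D :=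
    (hD.sub (integrable_const q)).pos_part
  filter_upwards [ae_tendsto_average hlaw hindep (φ := fun z => max (z - q) 0) (by fun_prop) hpos,
    ae_tendsto_average hlaw hindep measurable_id hD] with ω hω1 hω2 v hv
  have hlim := (hω1.const_add (lam * q)).sub (hω2.const_mul lam)
  rw [← integral_quantile_tail D hD (by linarith) h1] at hlim
  simp only [id, hD0, mul_zero, sub_zero] at hlim
  filter_upwards [hlim.eventually_lt_const hv, eventually_gt_atTop 0] with k hk hk0
  exact (detectionGap_le (fun (y : Fin m) (t : Fin k) => f y t ω) hk0 h0 h1 hyz q).trans_lt hk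

/-- Asymptotic lower bound: the threshold test for the law of the differences, applied to the
realized differences, yields couplings that are almost optimal in the limit. -/
lemma ae_eventually_exists_coupling (h0 : 0 < lam) (h1 : lam < 1) (hD : Integrable id D)
    (hD0 : ∫ z, z ∂D = 0) (y z : Fin m)
    (hlaw : ∀ s, HasLaw (fun ω => f y s ω - f z s ω) D μ)
    (hindep : Pairwise fun s t =>
      IndepFun (fun ω => f y s ω - f z s ω) (fun ω => f y t ω - f z t ω) μ) :
    ∀ᵐ ω ∂μ, ∀ v < ∫ u in (1 - lam)..1, quantile D u, ∀ᶠ k : ℕ in atTop,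
      ∃ π ∈ couplings k (pairDistribution lam y z),
        v ≤ separation (fun (y : Fin m) (t : Fin k) => f y t ω) (pairDistribution lam y z) π := by
  obtain ⟨h, hm, hh0, hh1, hlam, hhq⟩ := exists_thresholdTest D h0 h1
  have htail := integral_quantile_tail D hD h0 h1
  set q := quantile D (1 - lam) with hq
  have hpos : Integrable (fun z => max (z - q) 0) D :=
    (hD.sub (integrable_const q)).pos_part
  have hint : Integrable h D := by
    by_contra hcon
    rw [integral_undef hcon] at hlam
    exact h0.ne hlam
  have hmul : (fun z => h z * z) = fun z => q * h z + max (z - q) 0 := by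
    ext z
    rw [← hhq]
    ring
  have hmint : Integrable (fun z => h z * z) D := by
    rw [hmul]
    exact (hint.const_mul q).add hpos
  have hmval : ∫ z, h z * z ∂D = ∫ u in (1 - lam)..1, quantile D u := by
    rw [htail, hmul, integral_add (hint.const_mul q) hpos, integral_const_mul, hlam, mul_comm]
  filter_upwards [ae_tendsto_average hlaw hindep hm hint,
    ae_tendsto_average hlaw hindep (φ := fun z => h z * z) (hm.mul measurable_id) hmint,
    ae_tendsto_average hlaw hindep measurable_id hD] with ω hH hA hB v hv
  rw [hlam] at hH
  rw [hmval] at hA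
  simp only [id, hD0] at hB
  have l1 := (((tendsto_const_nhds (x := lam)).div hH h0.ne').mul hA).sub (hB.const_mul lam)
  have hratio := (tendsto_const_nhds (x := 1 - lam)).div (hH.const_sub 1) (by linarith)
  have l2 := (hB.sub (hratio.mul (hB.sub hA))).sub (hB.const_mul lam)
  have hlim := l1.min l2
  rw [div_self h0.ne', div_self (by linarith)] at hlim
  simp only [one_mul, mul_zero, sub_zero, zero_sub, neg_neg, min_self] at hlim
  filter_upwards [hlim.eventually_const_lt hv, eventually_gt_atTop 0] with k hk hk0
  obtain ⟨π, hπ, hle⟩ := exists_coupling_of_test (fun (y : Fin m) (t : Fin k) => f y t ω) hk0 h0 h1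
    y z (h := fun s => h (f y s ω - f z s ω)) (fun s => hh0 _) (fun s => hh1 _) rfl rfl rfl
  exact ⟨π, hπ, hk.le.trans hle⟩

end Convergence

/-- The common law of the differences of two distinct scores. -/
lemma hasLaw_sub_of_iIndepFun {Ω ι : Type*} [MeasurableSpace Ω] {μ : Measure Ω} {P : Measure ℝ}
    [IsProbabilityMeasure P] [IsProbabilityMeasure μ] {X : ι → Ω → ℝ} (hX : ∀ i, HasLaw (X i) P μ)
    (hindep : iIndepFun X μ) {i j : ι} (hij : i ≠ j) :
    HasLaw (fun ω => X i ω - X j ω) ((P.prod P).map fun p => p.1 - p.2) μ := by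
  have hprod := (hindep.indepFun hij).hasLaw_prod (hX i) (hX j)
  have hsub : HasLaw (fun p : ℝ × ℝ => p.1 - p.2) ((P.prod P).map fun p => p.1 - p.2) (P.prod P) :=
    ⟨by fun_prop, rfl⟩
  exact hsub.comp hprod

theorem theorem4 {Ω : Type*} [MeasurableSpace Ω] (μ : Measure Ω) [IsProbabilityMeasure μ]
    (PF : Measure ℝ) [IsProbabilityMeasure PF]
    (hmean : ∫ z, z ∂PF = 0) (hvar : variance id PF = 1)
    (hsub : ∃ ν b : ℝ, IsSubExponential PF ν b)
    (m : ℕ) (hm : 2 ≤ m) (lam : ℝ) (hlam : 1 / 2 ≤ lam) (hlam' : lam < 1)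
    (f : Fin m → ℕ → Ω → ℝ) (hlaw : ∀ x s, HasLaw (f x s) PF μ)
    (hindep : iIndepFun (fun (i : Fin m × ℕ) => f i.1 i.2) μ)
    (x x' : Fin m) (s s' : ℕ) (hne : (x, s) ≠ (x', s'))
    (Q : ℝ → ℝ) (hQ : Q = quantile (μ.map (fun ω => f x s ω - f x' s' ω))) :
    IntervalIntegrable Q volume (1 - lam) 1 ∧
      ∀ᵐ ω ∂μ, Tendsto
        (fun k : ℕ => detectionGap lam (fun (y : Fin m) (t : Fin k) => f y t ω))
        atTop (𝓝 (∫ u in (1 - lam)..1, Q u)) := by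
  -- a nonzero variance forces square integrability
  have hL2 : MemLp id 2 PF := by
    by_contra hcon
    rw [variance_of_not_memLp aestronglyMeasurable_id hcon] at hvar
    exact zero_ne_one hvar
  have hPF : Integrable (fun z : ℝ => z) PF := hL2.integrable (by norm_num)
  have hdiff : ∀ {i j : Fin m × ℕ}, i ≠ j →
      HasLaw (fun ω => f i.1 i.2 ω - f j.1 j.2 ω) ((PF.prod PF).map fun p => p.1 - p.2) μ :=
    fun hij => hasLaw_sub_of_iIndepFun (fun i => hlaw i.1 i.2) hindep hij
  rw [(hdiff hne).map_eq] at hQ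
  set D : Measure ℝ := (PF.prod PF).map fun p => p.1 - p.2 with hDdef
  have : IsProbabilityMeasure D := Measure.isProbabilityMeasure_map (by fun_prop)
  have hfst := hPF.comp_fst PF
  have hsnd := hPF.comp_snd PF
  have hD : Integrable id D :=
    (integrable_map_measure aestronglyMeasurable_id (by fun_prop)).2 (hfst.sub hsnd)
  have hD0 : ∫ z, z ∂D = 0 := by
    rw [hDdef, integral_map (f := fun z : ℝ => z) (by fun_prop) aestronglyMeasurable_id,
      integral_sub hfst hsnd, integral_fun_fst (fun z : ℝ => z), integral_fun_snd (fun z : ℝ => z),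
      hmean]
    simp
  subst hQ
  refine ⟨intervalIntegrable_quantile D hD (by linarith) hlam'.le, ?_⟩
  have hlawpair : ∀ y z : Fin m, y ≠ z → ∀ s, HasLaw (fun ω => f y s ω - f z s ω) D μ :=
    fun y z hyz s => hdiff (i := (y, s)) (j := (z, s)) (by simp [hyz])
  have hindeppair : ∀ y z : Fin m, Pairwise fun s t =>
      IndepFun (fun ω => f y s ω - f z s ω) (fun ω => f y t ω - f z t ω) μ := by
    intro y z s t hst
    have h := hindep.indepFun_prodMk_prodMk₀ (fun i => (hlaw i.1 i.2).aemeasurable)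
      (y, s) (z, s) (y, t) (z, t) (by simp [hst]) (by simp [hst]) (by simp [hst]) (by simp [hst])
    exact h.comp (φ := fun p : ℝ × ℝ => p.1 - p.2) (ψ := fun p : ℝ × ℝ => p.1 - p.2)
      (by fun_prop) (by fun_prop)
  have h01 : (⟨0, by omega⟩ : Fin m) ≠ ⟨1, by omega⟩ := by simp
  have hlower : ∀ᵐ ω ∂μ, ∀ y z : Fin m, y ≠ z →
      ∀ v < ∫ u in (1 - lam)..1, quantile D u, ∀ᶠ k : ℕ in atTop,
        ∃ π ∈ couplings k (pairDistribution lam y z),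
          v ≤ separation (fun (y : Fin m) (t : Fin k) => f y t ω)
            (pairDistribution lam y z) π := by
    refine ae_all_iff.2 fun y => ae_all_iff.2 fun z => ?_
    by_cases hyz : y = z
    · simp [hyz]
    · filter_upwards [ae_eventually_exists_coupling (by linarith) hlam' hD hD0 y z
        (hlawpair y z hyz) (hindeppair y z)] with ω hω _ using hω
  filter_upwards [hlower, ae_eventually_detectionGap_lt hlam hlam' hD hD0 h01
    (hlawpair _ _ h01) (hindeppair _ _)] with ω hω hup
  refine tendsto_order.2 ⟨fun v hv => ?_, hup⟩
  obtain ⟨w, hvw, hw⟩ := exists_between hv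
  have hev : ∀ᶠ k : ℕ in atTop, ∀ y z : Fin m, y ≠ z →
      ∃ π ∈ couplings k (pairDistribution lam y z),
        w ≤ separation (fun (y : Fin m) (t : Fin k) => f y t ω) (pairDistribution lam y z) π :=
    eventually_all.2 fun y => eventually_all.2 fun z => by
      by_cases hyz : y = z
      · simp [hyz]
      · filter_upwards [hω y z hyz w hw] with k hk _ using hk
  filter_upwards [hev] with k hk
  exact hvw.trans_le (le_detectionGap _ hm hlam hlam' hk)
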